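/- Let $G_{\mathrm{std}}$ be the standard space group $P4_122$, i.e. the group of affine transformations of $\mathbb{R}^3$ generated by the three unit translations along the coordinate axes, the screw motion $(x,y,z)\mapsto(-y,x,z+\tfrac14)$ and the half turn $(x,y,z)\mapsto(-x,y,-z)$. A group $G$ of isometries of Euclidean space $\mathbb{R}^3$ is said to be of type $P4_122$ if $G=\varphi\,G_{\mathrm{std}}\,\varphi^{-1}$ for some invertible affine transformation $\varphi$ of $\mathbb{R}^3$. A Dirichlet stereohedron for $G$ is the closed Voronoi region $$\mathrm{Vor}_{GP}(P)=\{x\in\mathbb{R}^3 : |x-P|\le |x-Q| \text{ for all } Q\in GP\}$$ of a point $P\in\mathbb{R}^3$ in the Voronoi diagram of its orbit $GP$; its facets are its two-dimensional faces. Then, for every group $G$ of type $P4_122$, every Dirichlet stereohedron for $G$ has at most $50$ facets. -/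

import Mathlib

/-- Euclidean 3-space. -/
abbrev E3 : Type := EuclideanSpace ℝ (Fin 3)

/-- The screw motion `(x, y, z) ↦ (-y, x, z + 1/4)`: a rotation of order four about the
`Z`-axis followed by a quarter of the vertical lattice translation. -/
noncomputable def screwFour : E3 ≃ᵃ[ℝ] E3 where
  toFun p := !₂[-p 1, p 0, p 2 + 1 / 4]
  invFun p := !₂[p 1, -p 0, p 2 - 1 / 4]
  left_inv p := by ext i; fin_cases i <;> simp
  right_inv p := by ext i; fin_cases i <;> simp
  linear :=
    { toFun := fun v => !₂[-v 1, v 0, v 2]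
      invFun := fun v => !₂[v 1, -v 0, v 2]
      map_add' := fun v w => by ext i; fin_cases i <;> simp [add_comm]
      map_smul' := fun c v => by ext i; fin_cases i <;> simp
      left_inv := fun v => by ext i; fin_cases i <;> simp
      right_inv := fun v => by ext i; fin_cases i <;> simp }
  map_vadd' p v := by ext i; fin_cases i <;> simp <;> ring

/-- The rotation of order two `(x, y, z) ↦ (-x, y, -z)` about the `Y`-axis. -/
noncomputable def halfTurnY : E3 ≃ᵃ[ℝ] E3 where
  toFun p := !₂[-p 0, p 1, -p 2]
  invFun p := !₂[-p 0, p 1, -p 2]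
  left_inv p := by ext i; fin_cases i <;> simp
  right_inv p := by ext i; fin_cases i <;> simp
  linear :=
    { toFun := fun v => !₂[-v 0, v 1, -v 2]
      invFun := fun v => !₂[-v 0, v 1, -v 2]
      map_add' := fun v w => by ext i; fin_cases i <;> simp [add_comm]
      map_smul' := fun c v => by ext i; fin_cases i <;> simp
      left_inv := fun v => by ext i; fin_cases i <;> simp
      right_inv := fun v => by ext i; fin_cases i <;> simp }
  map_vadd' p v := by ext i; fin_cases i <;> simp <;> ring

/-- The standard space group `P4₁22`, in the coordinates of the conventional unit cell: it is
generated by the three unit translations, the order-four screw motion and the half turn. Its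
elements are, up to integer translations, `(x, y, z)`, `(-x, -y, z + 1/2)`, `(-y, x, z + 1/4)`,
`(y, -x, z + 3/4)`, `(-x, y, -z)`, `(x, -y, -z + 1/2)`, `(y, x, -z + 3/4)`,
`(-y, -x, -z + 1/4)`. -/
noncomputable def standardP4122 : Subgroup (E3 ≃ᵃ[ℝ] E3) :=
  Subgroup.closure
    {AffineEquiv.constVAdd ℝ E3 (!₂[1, 0, 0] : E3), AffineEquiv.constVAdd ℝ E3 (!₂[0, 1, 0] : E3),
      AffineEquiv.constVAdd ℝ E3 (!₂[0, 0, 1] : E3), screwFour, halfTurnY}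

/-- A group of isometries of Euclidean 3-space is of type `P4₁22` if it is conjugate to the
standard group `P4₁22` by an affine transformation of space. -/
def IsOfTypeP4122 (G : Subgroup (E3 ≃ᵃⁱ[ℝ] E3)) : Prop :=
  ∃ φ : E3 ≃ᵃ[ℝ] E3,
    (fun g : E3 ≃ᵃⁱ[ℝ] E3 => g.toAffineEquiv) '' (G : Set (E3 ≃ᵃⁱ[ℝ] E3)) =
      (fun h : E3 ≃ᵃ[ℝ] E3 => φ * h * φ⁻¹) '' (standardP4122 : Set (E3 ≃ᵃ[ℝ] E3))

/-- The orbit `GP`. -/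
def orbitOf (G : Subgroup (E3 ≃ᵃⁱ[ℝ] E3)) (P : E3) : Set E3 :=
  {Q | ∃ g ∈ G, g P = Q}

/-- The closed Voronoi region of `P` in the Voronoi diagram of `S`. -/
def voronoiRegion (S : Set E3) (P : E3) : Set E3 :=
  {x | ∀ Q ∈ S, dist x P ≤ dist x Q}

/-- `C` is a Dirichlet stereohedron for `G`: the Voronoi region of a point in its `G`-orbit. -/
def IsDirichletStereohedron (G : Subgroup (E3 ≃ᵃⁱ[ℝ] E3)) (C : Set E3) : Prop :=
  ∃ P : E3, C = voronoiRegion (orbitOf G P) P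

/-- The facets of a convex body in 3-space: its (exposed) faces of dimension two. -/
def facets (C : Set E3) : Set (Set E3) :=
  {F | IsExposed ℝ C F ∧ Module.finrank ℝ (vectorSpan ℝ F) = 2}

/-- The positions, relative to a point `(x, y, z)`, of representatives of its `P4₁22`-orbit modulo
integer translations; `t` is the height of the image under the half turn `(y, x, -z + 3/4)`. -/
noncomputable def offset (x y t : ℝ) : Fin 8 → ℝ × ℝ × ℝ :=
  ![(0, 0, 0), (-x - y, x - y, 1 / 4), (-2 * x, -2 * y, 1 / 2), (y - x, -x - y, 3 / 4),
    (y - x, x - y, t), (-2 * x, 0, t + 1 / 4), (-x - y, -x - y, t + 1 / 2),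
    (0, -2 * y, t + 3 / 4)]

/-- The orbit point with given label, relative to the base point. -/
noncomputable def site (x y t : ℝ) (l : Fin 8 × ℤ × ℤ × ℤ) : ℝ × ℝ × ℝ :=
  ((offset x y t l.1).1 + l.2.1, (offset x y t l.1).2.1 + l.2.2.1,
    (offset x y t l.1).2.2 + l.2.2.2)

/-- The difference of the squared distances from a point `w` to `v` and to the origin, for the
form `X² + Y² + c Z²`, as a function of `v`; `α`, `β`, `γ` encode `w`. -/
def power (c α β γ : ℝ) (v : ℝ × ℝ × ℝ) : ℝ :=
  v.1 ^ 2 + v.2.1 ^ 2 + c * v.2.2 ^ 2 - α * v.1 - β * v.2.1 - γ * v.2.2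

/-- The bisector of the origin and `Q` contains a point that is strictly closer to the origin than
to all other sites. -/
def IsNeighbor (c x y t α β γ : ℝ) (Q : ℝ × ℝ × ℝ) : Prop :=
  power c α β γ Q = 0 ∧
    ∀ l, site x y t l ≠ 0 → site x y t l ≠ Q → 0 < power c α β γ (site x y t l)

/-- The labels that are not excluded by the lattice of translations; `k₅`, `k₆`, `k₇` are the
lowest admissible heights in three of the layers. -/
def candidates (k₅ k₆ k₇ : ℤ) : Finset (Fin 8 × ℤ × ℤ × ℤ) :=
  {(0, 1, 0, 0), (0, -1, 0, 0), (0, 0, 1, 0), (0, 0, -1, 0), (0, 0, 0, 1), (0, 0, 0, -1)} ∪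
  ({1} ×ˢ {0, 1} ×ˢ {-1, 0} ×ˢ {-1, 0} ∪ {2} ×ˢ {0, 1} ×ˢ {0, 1} ×ˢ {-1, 0} ∪
   {3} ×ˢ {0, 1} ×ˢ {0, 1} ×ˢ {-1, 0} ∪ {4} ×ˢ {0, 1} ×ˢ {-1, 0} ×ˢ {-1, 0} ∪
   {5} ×ˢ {0, 1} ×ˢ {0} ×ˢ {k₅, k₅ + 1} ∪ {6} ×ˢ {0, 1} ×ˢ {0, 1} ×ˢ {k₆, k₆ + 1} ∪
   {7} ×ˢ {0} ×ˢ {0, 1} ×ˢ {k₇, k₇ + 1})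

/-! ### Neighbours allowed by the translation lattice -/

section

variable {c x y t α β γ : ℝ}

theorem site_zero (i j k : ℤ) : site x y t (0, i, j, k) = ((i : ℝ), (j : ℝ), (k : ℝ)) := by
  simp [site, offset]

theorem site_shift (m : Fin 8) (i j k a b d : ℤ) :
    site x y t (m, i + a, j + b, k + d) = site x y t (m, i, j, k) + ((a : ℝ), (b : ℝ), (d : ℝ)) := by
  simp [site, add_assoc]

theorem power_zero : power c α β γ 0 = 0 := by simp [power]

theorem IsNeighbor.power_nonneg {Q : ℝ × ℝ × ℝ} (h : IsNeighbor c x y t α β γ Q)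
    (l : Fin 8 × ℤ × ℤ × ℤ) : 0 ≤ power c α β γ (site x y t l) := by
  by_cases h0 : site x y t l = 0
  · simp [h0, power_zero]
  by_cases h1 : site x y t l = Q
  · simp [h1, h.1]
  exact (h.2 l h0 h1).le

theorem mul_sq_sub_mul_pos {e δ : ℝ} {n : ℤ} (h1 : 0 < e - δ) (h2 : 0 < e + δ) (hn : n ≠ 0) :
    0 < e * (n : ℝ) ^ 2 - δ * n := by
  have he : 0 < e := by linarith
  rw [show e * (n : ℝ) ^ 2 - δ * n = n * (e * n - δ) by ring]
  rcases lt_or_gt_of_ne hn with hn | hn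
  · have h : (n : ℝ) ≤ -1 := by exact_mod_cast Int.le_sub_one_of_lt hn
    exact mul_pos_of_neg_of_neg (by linarith) (by nlinarith)
  · have h : (1 : ℝ) ≤ n := by exact_mod_cast hn
    exact mul_pos (by linarith) (by nlinarith)

/-- In its own translation lattice a site has at most the six obvious neighbours. -/
theorem IsNeighbor.mem_of_lattice {i j k : ℤ} {Q : ℝ × ℝ × ℝ}
    (h : IsNeighbor c x y t α β γ Q) (hQ : Q = ((i : ℝ), (j : ℝ), (k : ℝ))) (h0 : Q ≠ 0) :
    (i, j, k) ∈ ({(1, 0, 0), (-1, 0, 0), (0, 1, 0), (0, -1, 0), (0, 0, 1), (0, 0, -1)} :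
      Finset (ℤ × ℤ × ℤ)) := by
  subst hQ
  have hz := h.1
  have pos : ∀ a b d : ℤ, (a, b, d) ≠ (0, 0, 0) → (a, b, d) ≠ (i, j, k) →
      0 < (a : ℝ) ^ 2 + (b : ℝ) ^ 2 + c * (d : ℝ) ^ 2 - α * a - β * b - γ * d := by
    intro a b d h1 h2
    have := h.2 (0, a, b, d) (by rw [site_zero]; simpa using h1) (by rw [site_zero]; simpa using h2)
    rwa [site_zero] at this
  simp only [power] at hz
  have hne : ¬ (i = 0 ∧ j = 0 ∧ k = 0) := by simpa using h0
  -- Along orthogonal summands `power` is additive, so a neighbour cannot split into two nonzero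
  -- lattice vectors along different coordinate axes: both would have positive power.
  have hij : i = 0 ∨ (j = 0 ∧ k = 0) := by
    by_contra! hcon
    have h1 := pos i 0 0 (by simp [hcon.1]) (by
      simp only [ne_eq, Prod.mk.injEq, true_and]; intro h; exact hcon.2 h.1.symm h.2.symm)
    have h2 := pos 0 j k (by
      simp only [ne_eq, Prod.mk.injEq, true_and]; intro h; exact hcon.2 h.1 h.2)
      (by simp [Ne.symm hcon.1])
    push_cast at h1 h2
    linarith
  have hjk : j = 0 ∨ k = 0 := by
    by_contra! hcon
    have hi : i = 0 := by tauto
    subst hi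
    have h1 := pos 0 j 0 (by simp [hcon.1]) (by simp [Ne.symm hcon.2])
    have h2 := pos 0 0 k (by simp [hcon.2]) (by simp [Ne.symm hcon.1])
    push_cast at h1 h2 hz
    linarith
  have vanish : ∀ v : ℤ × ℤ × ℤ, v ≠ (0, 0, 0) → v ≠ (i, j, k) → (-v.1, -v.2.1, -v.2.2) ≠ (i, j, k) →
      0 < v.1 ^ 2 + v.2.1 ^ 2 + c * v.2.2 ^ 2 - (α * v.1 + β * v.2.1 + γ * v.2.2) ∧
      0 < v.1 ^ 2 + v.2.1 ^ 2 + c * v.2.2 ^ 2 + (α * v.1 + β * v.2.1 + γ * v.2.2) := by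
    rintro ⟨a, b, d⟩ h1 h2 h3
    have p1 := pos a b d h1 h2
    have p2 := pos (-a) (-b) (-d) (by simpa using h1) h3
    push_cast at p1 p2
    exact ⟨by linarith, by linarith⟩
  by_contra hmem
  simp only [Finset.mem_insert, Finset.mem_singleton, Prod.mk.injEq, not_or] at hmem
  obtain ⟨m1, m2, m3, m4, m5, m6⟩ := hmem
  by_cases hi : i = 0
  · subst hi
    by_cases hj : j = 0
    · subst hj
      have hk : k ≠ 0 := fun hk => hne ⟨rfl, rfl, hk⟩
      have h1 := vanish (0, 0, 1) (by simp) (by rintro ⟨⟩; simp at m5) (by rintro ⟨⟩; simp at m6)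
      push_cast at h1 hz
      have := mul_sq_sub_mul_pos (e := c) (δ := γ) (by linarith) (by linarith) hk
      linarith
    · obtain rfl : k = 0 := hjk.resolve_left hj
      have h1 := vanish (0, 1, 0) (by simp) (by rintro ⟨⟩; simp at m3) (by rintro ⟨⟩; simp at m4)
      push_cast at h1 hz
      have := mul_sq_sub_mul_pos (e := 1) (δ := β) (by linarith) (by linarith) hj
      linarith
  · obtain ⟨rfl, rfl⟩ : j = 0 ∧ k = 0 := hij.resolve_left hi
    have h1 := vanish (1, 0, 0) (by simp) (by rintro ⟨⟩; simp at m1) (by rintro ⟨⟩; simp at m2)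
    push_cast at h1 hz
    have := mul_sq_sub_mul_pos (e := 1) (δ := α) (by linarith) (by linarith) hi
    linarith

/-- Sites outside the translation lattice. -/
def OffLattice (Q : ℝ × ℝ × ℝ) : Prop := ∀ i j k : ℤ, Q ≠ ((i : ℝ), (j : ℝ), (k : ℝ))

theorem IsNeighbor.lattice_pos {Q : ℝ × ℝ × ℝ} (h : IsNeighbor c x y t α β γ Q)
    (hQ : OffLattice Q) (a b d : ℤ) (hne : ((a : ℝ), (b : ℝ), (d : ℝ)) ≠ 0) :
    0 < (a : ℝ) ^ 2 + (b : ℝ) ^ 2 + c * (d : ℝ) ^ 2 - α * a - β * b - γ * d := by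
  have := h.2 (0, a, b, d) (by rwa [site_zero]) (by rw [site_zero]; exact (hQ a b d).symm)
  rwa [site_zero] at this

theorem IsNeighbor.shift_pos {l : Fin 8 × ℤ × ℤ × ℤ} (h : IsNeighbor c x y t α β γ (site x y t l))
    (hQ : OffLattice (site x y t l)) (a b d : ℤ) (hne : ((a : ℝ), (b : ℝ), (d : ℝ)) ≠ 0) :
    0 < power c α β γ (site x y t l + ((a : ℝ), (b : ℝ), (d : ℝ))) := by
  obtain ⟨m, i, j, k⟩ := l
  rw [← site_shift]
  refine h.2 _ ?_ ?_
  · rw [site_shift]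
    intro h0
    refine hQ (-a) (-b) (-d) ?_
    rw [eq_neg_of_add_eq_zero_left h0]
    simp
  · rw [site_shift]
    simpa using hne

/-- For a unit lattice vector `e`, both `e` and `Q - e` have positive power, while `Q` has power 0.
In the sum the linear parts cancel against that of `Q`, leaving `⟨Q, e⟩ < ⟨e, e⟩`; take `e` to be
plus or minus each axis vector. -/
theorem IsNeighbor.bounds {l : Fin 8 × ℤ × ℤ × ℤ} (hc : 0 < c)
    (h : IsNeighbor c x y t α β γ (site x y t l)) (hQ : OffLattice (site x y t l)) :
    |(site x y t l).1| < 1 ∧ |(site x y t l).2.1| < 1 ∧ |(site x y t l).2.2| < 1 := by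
  have hz := h.1
  have a1 := h.lattice_pos hQ 1 0 0 (by simp)
  have a2 := h.lattice_pos hQ (-1) 0 0 (by simp)
  have a3 := h.lattice_pos hQ 0 1 0 (by simp)
  have a4 := h.lattice_pos hQ 0 (-1) 0 (by simp)
  have a5 := h.lattice_pos hQ 0 0 1 (by simp)
  have a6 := h.lattice_pos hQ 0 0 (-1) (by simp)
  have b1 := h.shift_pos hQ 1 0 0 (by simp)
  have b2 := h.shift_pos hQ (-1) 0 0 (by simp)
  have b3 := h.shift_pos hQ 0 1 0 (by simp)
  have b4 := h.shift_pos hQ 0 (-1) 0 (by simp)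
  have b5 := h.shift_pos hQ 0 0 1 (by simp)
  have b6 := h.shift_pos hQ 0 0 (-1) (by simp)
  generalize site x y t l = Q at *
  obtain ⟨X, Y, Z⟩ := Q
  simp only [power, Prod.mk_add_mk] at *
  push_cast at *
  simp only [abs_lt]
  refine ⟨⟨by linarith, by linarith⟩, ⟨by linarith, by linarith⟩, ?_, ?_⟩
  · by_contra! hcon
    nlinarith
  · by_contra! hcon
    nlinarith

end

/-! ### Excluding four of the 54 candidates -/

section

variable {c x y t α β γ : ℝ}

/-- The linear part of `power` respects the relation, so only the quadratic parts must be compared.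
Horizontal and vertical parts are compared separately because `c` is an arbitrary positive number.
-/
theorem power_pos_of_combination {Q R A B : ℝ × ℝ × ℝ} {r s : ℝ} (hc : 0 < c)
    (hX : Q.1 = R.1 + r * A.1 + s * B.1) (hY : Q.2.1 = R.2.1 + r * A.2.1 + s * B.2.1)
    (hZ : Q.2.2 = R.2.2 + r * A.2.2 + s * B.2.2) (hr : 0 ≤ r) (hs : 0 ≤ s)
    (hH : R.1 ^ 2 + R.2.1 ^ 2 + r * (A.1 ^ 2 + A.2.1 ^ 2) + s * (B.1 ^ 2 + B.2.1 ^ 2) ≤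
      Q.1 ^ 2 + Q.2.1 ^ 2)
    (hV : R.2.2 ^ 2 + r * A.2.2 ^ 2 + s * B.2.2 ^ 2 ≤ Q.2.2 ^ 2)
    (hstrict : 0 < s ∨ R.2.2 ^ 2 + r * A.2.2 ^ 2 + s * B.2.2 ^ 2 < Q.2.2 ^ 2)
    (hR : 0 ≤ power c α β γ R) (hA : 0 ≤ power c α β γ A) (hB : 0 < power c α β γ B) :
    0 < power c α β γ Q := by
  have key : power c α β γ Q = power c α β γ R + r * power c α β γ A + s * power c α β γ B +
      (Q.1 ^ 2 + Q.2.1 ^ 2 -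
        (R.1 ^ 2 + R.2.1 ^ 2 + r * (A.1 ^ 2 + A.2.1 ^ 2) + s * (B.1 ^ 2 + B.2.1 ^ 2))) +
      c * (Q.2.2 ^ 2 - (R.2.2 ^ 2 + r * A.2.2 ^ 2 + s * B.2.2 ^ 2)) := by
    simp only [power]
    linear_combination (-α) * hX - β * hY - γ * hZ
  have h1 := mul_nonneg hr hA
  have h2 := mul_nonneg hs hB.le
  have h3 := mul_nonneg hc.le (sub_nonneg.2 hV)
  rcases hstrict with h | h
  · have := mul_pos h hB
    linarith
  · have := mul_pos hc (sub_pos.2 h)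
    linarith

/-- Here `B = (0, 0, ±1)`, whose power is strictly positive since `Q` is off the lattice. For `R`
and `A` nonnegativity is enough, so they may coincide with the origin or with `Q`. -/
theorem IsNeighbor.not_combination {lQ lR lA : Fin 8 × ℤ × ℤ × ℤ} {r s : ℝ} (b : ℤ)
    (hb : b ^ 2 = 1) (hc : 0 < c) (h : IsNeighbor c x y t α β γ (site x y t lQ))
    (hQ : OffLattice (site x y t lQ)) (hr : 0 ≤ r) (hs : 0 ≤ s)
    (hX : (site x y t lQ).1 = (site x y t lR).1 + r * (site x y t lA).1)
    (hY : (site x y t lQ).2.1 = (site x y t lR).2.1 + r * (site x y t lA).2.1)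
    (hZ : (site x y t lQ).2.2 = (site x y t lR).2.2 + r * (site x y t lA).2.2 + s * b)
    (hH : (site x y t lR).1 ^ 2 + (site x y t lR).2.1 ^ 2 +
      r * ((site x y t lA).1 ^ 2 + (site x y t lA).2.1 ^ 2) ≤
      (site x y t lQ).1 ^ 2 + (site x y t lQ).2.1 ^ 2)
    (hV : (site x y t lR).2.2 ^ 2 + r * (site x y t lA).2.2 ^ 2 + s ≤ (site x y t lQ).2.2 ^ 2)
    (hstrict : 0 < s ∨
      (site x y t lR).2.2 ^ 2 + r * (site x y t lA).2.2 ^ 2 + s < (site x y t lQ).2.2 ^ 2) :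
    False := by
  have hb' : (b : ℝ) ^ 2 = 1 := by exact_mod_cast hb
  have hb0 : (b : ℝ) ≠ 0 := by
    intro h0
    simp [h0] at hb'
  have hB := h.lattice_pos hQ 0 0 b (by simpa using hb0)
  refine (power_pos_of_combination (α := α) (β := β) (γ := γ) (B := (0, 0, (b : ℝ))) hc
    (by simpa using hX) (by simpa using hY) hZ hr hs (by simpa using hH) (by simpa [hb'] using hV)
    (by simpa [hb'] using hstrict) (h.power_nonneg lR) (h.power_nonneg lA) ?_).ne' h.1
  simp only [power]
  push_cast at hB
  linarith

theorem int_mem_pair {n a : ℤ} {u : ℝ} (h : |u + n| < 1) (h0 : u + a ≤ 0) (h1 : -1 ≤ u + a) :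
    n = a ∨ n = a + 1 := by
  rw [abs_lt] at h
  have h2 : (a : ℝ) < n + 1 := by linarith
  have h3 : (n : ℝ) < a + 2 := by linarith
  have h4 : a < n + 1 := by exact_mod_cast h2
  have h5 : n < a + 2 := by exact_mod_cast h3
  omega

theorem IsNeighbor.mem_candidates {l : Fin 8 × ℤ × ℤ × ℤ} {k₅ k₆ k₇ : ℤ} (hc : 0 < c)
    (hy : 0 ≤ y) (hyx : y ≤ x) (hx : x ≤ 1 / 2) (ht0 : 0 ≤ t) (ht1 : t < 1)
    (h₅ : t + 1 / 4 + k₅ ≤ 0) (h₅' : -1 ≤ t + 1 / 4 + k₅)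
    (h₆ : t + 1 / 2 + k₆ ≤ 0) (h₆' : -1 ≤ t + 1 / 2 + k₆)
    (h₇ : t + 3 / 4 + k₇ ≤ 0) (h₇' : -1 ≤ t + 3 / 4 + k₇)
    (h : IsNeighbor c x y t α β γ (site x y t l)) (hQ : OffLattice (site x y t l)) :
    l ∈ candidates k₅ k₆ k₇ := by
  obtain ⟨hX, hY, hZ⟩ := h.bounds hc hQ
  obtain ⟨m, i, j, k⟩ := l
  have fromZero : ∀ {n : ℤ} {u : ℝ}, |u + n| < 1 → u ≤ 0 → -1 ≤ u → n = 0 ∨ n = 1 := by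
    intro n u h1 h2 h3
    exact int_mem_pair (a := 0) h1 (by simpa using h2) (by simpa using h3)
  have fromNeg : ∀ {n : ℤ} {u : ℝ}, |u + n| < 1 → u ≤ 1 → 0 ≤ u → n = -1 ∨ n = 0 := by
    intro n u h1 h2 h3
    exact int_mem_pair (a := -1) h1 (by push_cast; linarith) (by push_cast; linarith)
  fin_cases m <;> simp only [site, offset, Fin.reduceFinMk, Matrix.cons_val] at hX hY hZ <;>
    simp only [candidates, Finset.mem_union, Finset.mem_product, Finset.mem_insert,
      Finset.mem_singleton, Prod.mk.injEq, Fin.reduceFinMk, Fin.reduceEq, Fin.zero_eta,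
      true_and, false_and, or_false, false_or]
  · exact absurd (site_zero i j k) (hQ i j k)
  · exact ⟨fromZero hX (by linarith) (by linarith), fromNeg hY (by linarith) (by linarith),
      fromNeg hZ (by linarith) (by linarith)⟩
  · exact ⟨fromZero hX (by linarith) (by linarith), fromZero hY (by linarith) (by linarith),
      fromNeg hZ (by linarith) (by linarith)⟩
  · exact ⟨fromZero hX (by linarith) (by linarith), fromZero hY (by linarith) (by linarith),
      fromNeg hZ (by linarith) (by linarith)⟩
  · exact ⟨fromZero hX (by linarith) (by linarith), fromNeg hY (by linarith) (by linarith),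
      fromNeg hZ (by linarith) (by linarith)⟩
  -- The fifth coset has second offset 0, so the strict bound leaves one integer instead of two.
  · refine ⟨fromZero hX (by linarith) (by linarith), ?_, int_mem_pair hZ h₅ h₅'⟩
    rw [zero_add] at hY
    exact Int.abs_lt_one_iff.1 (by exact_mod_cast hY)
  · exact ⟨fromZero hX (by linarith) (by linarith), fromZero hY (by linarith) (by linarith),
      int_mem_pair hZ h₆ h₆'⟩
  · refine ⟨?_, fromZero hY (by linarith) (by linarith), int_mem_pair hZ h₇ h₇'⟩
    rw [zero_add] at hX
    exact Int.abs_lt_one_iff.1 (by exact_mod_cast hX)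

/-- All neighbours occur among the sites labelled by `T`. -/
def CoversNeighbors (c x y t : ℝ) (T : Finset (Fin 8 × ℤ × ℤ × ℤ)) : Prop :=
  ∀ l, site x y t l ≠ 0 → (∃ α β γ, IsNeighbor c x y t α β γ (site x y t l)) →
    ∃ l' ∈ T, site x y t l' = site x y t l

/-- For special base points a site of another coset label may lie in `ℤ³`. It is then counted
through its label in coset 0, which is why `E` must avoid that coset. -/
theorem coversNeighbors_of_excluded {k₅ k₆ k₇ : ℤ} {E : Finset (Fin 8 × ℤ × ℤ × ℤ)} (hc : 0 < c)
    (hy : 0 ≤ y) (hyx : y ≤ x) (hx : x ≤ 1 / 2) (ht0 : 0 ≤ t) (ht1 : t < 1)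
    (h₅ : t + 1 / 4 + k₅ ≤ 0) (h₅' : -1 ≤ t + 1 / 4 + k₅)
    (h₆ : t + 1 / 2 + k₆ ≤ 0) (h₆' : -1 ≤ t + 1 / 2 + k₆)
    (h₇ : t + 3 / 4 + k₇ ≤ 0) (h₇' : -1 ≤ t + 3 / 4 + k₇)
    (hE0 : ∀ l ∈ E, l.1 ≠ 0)
    (hE : ∀ l ∈ E, ∀ α β γ, IsNeighbor c x y t α β γ (site x y t l) →
      ¬ OffLattice (site x y t l)) :
    CoversNeighbors c x y t (candidates k₅ k₆ k₇ \ E) := by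
  rintro l h0 ⟨α, β, γ, h⟩
  by_cases hQ : OffLattice (site x y t l)
  · exact ⟨l, Finset.mem_sdiff.2 ⟨h.mem_candidates hc hy hyx hx ht0 ht1 h₅ h₅' h₆ h₆' h₇ h₇' hQ,
      fun hl => hE l hl α β γ h hQ⟩, rfl⟩
  · obtain ⟨i, j, k, hijk⟩ : ∃ i j k : ℤ, site x y t l = ((i : ℝ), (j : ℝ), (k : ℝ)) := by
      simpa [OffLattice] using hQ
    refine ⟨(0, i, j, k), Finset.mem_sdiff.2 ⟨?_, fun hl => hE0 _ hl rfl⟩, by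
      rw [site_zero, hijk]⟩
    have := h.mem_of_lattice hijk h0
    simp only [Finset.mem_insert, Finset.mem_singleton] at this
    refine Finset.mem_union_left _ ?_
    rcases this with h | h | h | h | h | h <;> simp [h]

/-- Cosets 1 and 6 share their first offset, cosets 3 and 6 their second, so the excluded sites
arise from coset 6 by adding multiples of a horizontal and a vertical unit vector. The vertical
comparison reads `t ² + 1/2 ≤ 9/16`, that is `|t| ≤ 1/4`. -/
theorem exists_covers_of_lt_quarter (hc : 0 < c) (hy : 0 ≤ y) (hyx : y ≤ x) (hx : x ≤ 1 / 2)
    (ht0 : 0 ≤ t) (ht : t < 1 / 4) : ∃ T, T.card ≤ 50 ∧ CoversNeighbors c x y t T := by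
  refine ⟨candidates (-1) (-1) (-1) \
    {(1, 0, -1, -1), (1, 1, -1, -1), (3, 1, 0, 0), (3, 1, 1, 0)}, by decide +kernel,
    coversNeighbors_of_excluded hc hy hyx hx ht0 (by linarith) (by norm_num; linarith)
      (by norm_num; linarith) (by norm_num; linarith) (by norm_num; linarith)
      (by norm_num; linarith) (by norm_num; linarith) (by decide) ?_⟩
  intro l hl α β γ h hQ
  have e1 : 0 ≤ 1 - 2 * x := by linarith
  simp only [Finset.mem_insert, Finset.mem_singleton] at hl
  rcases hl with rfl | rfl | rfl | rfl
  · refine h.not_combination (lR := (6, 0, 0, -1)) (lA := (0, 0, -1, 0)) (r := 1 - 2 * x)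
      (s := 1 / 4 + t) (-1) (by norm_num) hc hQ e1 (by linarith) ?_ ?_ ?_ ?_ ?_
      (Or.inl (by linarith)) <;> simp [site, offset] <;> nlinarith [mul_nonneg hy e1]
  · refine h.not_combination (lR := (6, 1, 0, -1)) (lA := (0, 0, -1, 0)) (r := 1 - 2 * x)
      (s := 1 / 4 + t) (-1) (by norm_num) hc hQ e1 (by linarith) ?_ ?_ ?_ ?_ ?_
      (Or.inl (by linarith)) <;> simp [site, offset] <;> nlinarith [mul_nonneg hy e1]
  · refine h.not_combination (lR := (6, 1, 0, 0)) (lA := (0, 1, 0, 0)) (r := 2 * y)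
      (s := 1 / 4 - t) 1 (by norm_num) hc hQ (by linarith) (by linarith) ?_ ?_ ?_ ?_ ?_
      (Or.inl (by linarith)) <;> simp [site, offset] <;> nlinarith [mul_nonneg hy e1]
  · refine h.not_combination (lR := (6, 1, 1, 0)) (lA := (0, 1, 0, 0)) (r := 2 * y)
      (s := 1 / 4 - t) 1 (by norm_num) hc hQ (by linarith) (by linarith) ?_ ?_ ?_ ?_ ?_
      (Or.inl (by linarith)) <;> simp [site, offset] <;> nlinarith [mul_nonneg hy e1]

/-- The previous case with `t - 1` in place of `t`: the same sites are excluded and the labels in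
coset 6 drop by one. -/
theorem exists_covers_of_three_quarters_lt (hc : 0 < c) (hy : 0 ≤ y) (hyx : y ≤ x)
    (hx : x ≤ 1 / 2) (ht : 3 / 4 < t) (ht1 : t < 1) :
    ∃ T, T.card ≤ 50 ∧ CoversNeighbors c x y t T := by
  refine ⟨candidates (-2) (-2) (-2) \
    {(1, 0, -1, -1), (1, 1, -1, -1), (3, 1, 0, 0), (3, 1, 1, 0)}, by decide +kernel,
    coversNeighbors_of_excluded hc hy hyx hx (by linarith) ht1 (by norm_num; linarith)
      (by norm_num; linarith) (by norm_num; linarith) (by norm_num; linarith)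
      (by norm_num; linarith) (by norm_num; linarith) (by decide) ?_⟩
  intro l hl α β γ h hQ
  have e1 : 0 ≤ 1 - 2 * x := by linarith
  simp only [Finset.mem_insert, Finset.mem_singleton] at hl
  rcases hl with rfl | rfl | rfl | rfl
  · refine h.not_combination (lR := (6, 0, 0, -2)) (lA := (0, 0, -1, 0)) (r := 1 - 2 * x)
      (s := t - 3 / 4) (-1) (by norm_num) hc hQ e1 (by linarith) ?_ ?_ ?_ ?_ ?_
      (Or.inl (by linarith)) <;> simp [site, offset] <;> nlinarith [mul_nonneg hy e1]
  · refine h.not_combination (lR := (6, 1, 0, -2)) (lA := (0, 0, -1, 0)) (r := 1 - 2 * x)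
      (s := t - 3 / 4) (-1) (by norm_num) hc hQ e1 (by linarith) ?_ ?_ ?_ ?_ ?_
      (Or.inl (by linarith)) <;> simp [site, offset] <;> nlinarith [mul_nonneg hy e1]
  · refine h.not_combination (lR := (6, 1, 0, -1)) (lA := (0, 1, 0, 0)) (r := 2 * y)
      (s := 5 / 4 - t) 1 (by norm_num) hc hQ (by linarith) (by linarith) ?_ ?_ ?_ ?_ ?_
      (Or.inl (by linarith)) <;> simp [site, offset] <;> nlinarith [mul_nonneg hy e1]
  · refine h.not_combination (lR := (6, 1, 1, -1)) (lA := (0, 1, 0, 0)) (r := 2 * y)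
      (s := 5 / 4 - t) 1 (by norm_num) hc hQ (by linarith) (by linarith) ?_ ?_ ?_ ?_ ?_
      (Or.inl (by linarith)) <;> simp [site, offset] <;> nlinarith [mul_nonneg hy e1]

/-- Division that tolerates `b = 0`, needed at the vertices `x = y = 1/2` and `x = y = 0` of the
triangle. -/
theorem exists_mul_eq_of_le {a b : ℝ} (ha : 0 ≤ a) (hab : a ≤ b) :
    ∃ r, 0 ≤ r ∧ r ≤ 1 ∧ a = r * b := by
  rcases eq_or_lt_of_le (ha.trans hab) with hb | hb
  · exact ⟨0, le_rfl, zero_le_one, by linarith⟩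
  · exact ⟨a / b, by positivity, (div_le_one hb).2 hab, by field_simp⟩

/-- The site `A = (0, 1 - 2y, t - 1/4)` scaled by `r = (1 - 2x)/(1 - 2y)` bridges cosets 4 and 3,
and cosets 1 and 6. The horizontal comparison is an equality; `h2` and `h3` give the vertical one.
-/
theorem exists_covers_of_lt_half (hc : 0 < c) (hy : 0 ≤ y) (hyx : y ≤ x) (hx : x ≤ 1 / 2)
    (ht0 : 1 / 4 ≤ t) (ht : t < 1 / 2) : ∃ T, T.card ≤ 50 ∧ CoversNeighbors c x y t T := by
  refine ⟨candidates (-1) (-1) (-2) \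
    {(3, 0, 1, 0), (3, 1, 1, 0), (6, 0, 1, 0), (6, 1, 1, 0)}, by decide +kernel,
    coversNeighbors_of_excluded hc hy hyx hx (by linarith) (by linarith) (by norm_num; linarith)
      (by norm_num; linarith) (by norm_num; linarith) (by norm_num; linarith)
      (by norm_num; linarith) (by norm_num; linarith) (by decide) ?_⟩
  intro l hl α β γ h hQ
  obtain ⟨r, hr0, hr1, hr⟩ := exists_mul_eq_of_le (a := 1 - 2 * x) (b := 1 - 2 * y)
    (by linarith) (by linarith)
  obtain rfl : x = (1 - r * (1 - 2 * y)) / 2 := by linarith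
  have h1 : r * (t - 1 / 4) ≤ t - 1 / 4 := mul_le_of_le_one_left (by linarith) hr1
  have h2 : 0 ≤ (t - 1 / 4) * (3 / 4 - t) := mul_nonneg (by linarith) (by linarith)
  have h3 : 0 ≤ r * ((t - 1 / 4) * (5 / 4 - t)) :=
    mul_nonneg hr0 (mul_nonneg (by linarith) (by linarith))
  simp only [Finset.mem_insert, Finset.mem_singleton] at hl
  rcases hl with rfl | rfl | rfl | rfl
  · refine h.not_combination (lR := (4, 0, 0, 0)) (lA := (7, 0, 1, -1)) (r := r)
      (s := 3 / 4 - t - r * (t - 1 / 4)) 1 (by norm_num) hc hQ hr0 (by linarith) ?_ ?_ ?_ ?_ ?_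
      (Or.inl (by linarith)) <;> simp [site, offset] <;> nlinarith
  · refine h.not_combination (lR := (4, 1, 0, 0)) (lA := (7, 0, 1, -1)) (r := r)
      (s := 3 / 4 - t - r * (t - 1 / 4)) 1 (by norm_num) hc hQ hr0 (by linarith) ?_ ?_ ?_ ?_ ?_
      (Or.inl (by linarith)) <;> simp [site, offset] <;> nlinarith
  · refine h.not_combination (lR := (1, 0, 0, 0)) (lA := (7, 0, 1, -1)) (r := r)
      (s := t + 1 / 4 - r * (t - 1 / 4)) 1 (by norm_num) hc hQ hr0 (by linarith) ?_ ?_ ?_ ?_ ?_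
      (Or.inl (by linarith)) <;> simp [site, offset] <;> nlinarith
  · refine h.not_combination (lR := (1, 1, 0, 0)) (lA := (7, 0, 1, -1)) (r := r)
      (s := t + 1 / 4 - r * (t - 1 / 4)) 1 (by norm_num) hc hQ hr0 (by linarith) ?_ ?_ ?_ ?_ ?_
      (Or.inl (by linarith)) <;> simp [site, offset] <;> nlinarith

/-- Now `A = (-2x, 0, t - 3/4)` with `r = y/x` bridges cosets 4 and 1, and cosets 3 and 6. -/
theorem exists_covers_of_half_le (hc : 0 < c) (hy : 0 ≤ y) (hyx : y ≤ x) (hx : x ≤ 1 / 2)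
    (ht0 : 1 / 2 ≤ t) (ht : t ≤ 3 / 4) : ∃ T, T.card ≤ 50 ∧ CoversNeighbors c x y t T := by
  refine ⟨candidates (-1) (-2) (-2) \
    {(1, 0, -1, -1), (1, 0, 0, -1), (6, 0, 0, -2), (6, 0, 1, -2)}, by decide +kernel,
    coversNeighbors_of_excluded hc hy hyx hx (by linarith) (by linarith) (by norm_num; linarith)
      (by norm_num; linarith) (by norm_num; linarith) (by norm_num; linarith)
      (by norm_num; linarith) (by norm_num; linarith) (by decide) ?_⟩
  intro l hl α β γ h hQ
  obtain ⟨r, hr0, hr1, rfl⟩ := exists_mul_eq_of_le hy hyx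
  have h1 : r * (3 / 4 - t) ≤ 3 / 4 - t := mul_le_of_le_one_left (by linarith) hr1
  have h2 : 0 ≤ (t - 1 / 4) * (3 / 4 - t) := mul_nonneg (by linarith) (by linarith)
  have h3 : 0 ≤ r * ((3 / 4 - t) * (1 / 4 + t)) :=
    mul_nonneg hr0 (mul_nonneg (by linarith) (by linarith))
  -- At `t = 1/2` and `r = 1` the weight `s` is 0; there strictness comes from the vertical
  -- comparison.
  have h4 : 0 < t - 1 / 4 - r * (3 / 4 - t) ∨ (3 / 4 - t = 1 / 4) := by
    rcases eq_or_lt_of_le ht0 with h | h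
    · right; linarith
    · left; linarith
  simp only [Finset.mem_insert, Finset.mem_singleton] at hl
  rcases hl with rfl | rfl | rfl | rfl
  · refine h.not_combination (lR := (4, 0, -1, -1)) (lA := (5, 0, 0, -1)) (r := r)
      (s := t - 1 / 4 - r * (3 / 4 - t)) (-1) (by norm_num) hc hQ hr0 (by linarith) ?_ ?_ ?_ ?_ ?_
      (h4.imp_right fun h4 => ?_) <;> simp [site, offset] <;> nlinarith
  · refine h.not_combination (lR := (4, 0, 0, -1)) (lA := (5, 0, 0, -1)) (r := r)
      (s := t - 1 / 4 - r * (3 / 4 - t)) (-1) (by norm_num) hc hQ hr0 (by linarith) ?_ ?_ ?_ ?_ ?_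
      (h4.imp_right fun h4 => ?_) <;> simp [site, offset] <;> nlinarith
  · refine h.not_combination (lR := (3, 0, 0, -1)) (lA := (5, 0, 0, -1)) (r := r)
      (s := 5 / 4 - t - r * (3 / 4 - t)) (-1) (by norm_num) hc hQ hr0 (by linarith) ?_ ?_ ?_ ?_ ?_
      (Or.inl (by linarith)) <;> simp [site, offset] <;> nlinarith
  · refine h.not_combination (lR := (3, 0, 1, -1)) (lA := (5, 0, 0, -1)) (r := r)
      (s := 5 / 4 - t - r * (3 / 4 - t)) (-1) (by norm_num) hc hQ hr0 (by linarith) ?_ ?_ ?_ ?_ ?_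
      (Or.inl (by linarith)) <;> simp [site, offset] <;> nlinarith

theorem exists_covers (hc : 0 < c) (hy : 0 ≤ y) (hyx : y ≤ x) (hx : x ≤ 1 / 2)
    (ht0 : 0 ≤ t) (ht1 : t < 1) : ∃ T, T.card ≤ 50 ∧ CoversNeighbors c x y t T := by
  rcases lt_or_ge t (1 / 4) with h1 | h1
  · exact exists_covers_of_lt_quarter hc hy hyx hx ht0 h1
  rcases lt_or_ge t (1 / 2) with h2 | h2
  · exact exists_covers_of_lt_half hc hy hyx hx h1 h2
  rcases le_or_gt t (3 / 4) with h3 | h3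
  · exact exists_covers_of_half_le hc hy hyx hx h2 h3
  · exact exists_covers_of_three_quarters_lt hc hy hyx hx h3 ht1

end

/-! ### Facets of Voronoi regions and strict neighbours -/

open scoped RealInnerProductSpace in
theorem dist_sq_sub_dist_sq (P R w x : E3) :
    dist x R ^ 2 - dist x P ^ 2 = dist w R ^ 2 - dist w P ^ 2 + 2 * ⟪P - R, x - w⟫ := by
  have key : ∀ T : E3, dist x T ^ 2 = dist w T ^ 2 + 2 * ⟪w - T, x - w⟫ + ‖x - w‖ ^ 2 := by
    intro T
    rw [dist_eq_norm, dist_eq_norm, ← norm_add_sq_real]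
    congr 2
    abel
  rw [key R, key P, show P - R = (w - R) - (w - P) by abel, inner_sub_left (w - R)]
  ring

theorem convex_voronoiRegion (S : Set E3) (P : E3) : Convex ℝ (voronoiRegion S P) := by
  have h : voronoiRegion S P =
      ⋂ Q ∈ S, {x : E3 | inner ℝ (Q - P) x ≤ (dist 0 Q ^ 2 - dist 0 P ^ 2) / 2} := by
    ext x
    simp only [voronoiRegion, Set.mem_ofPred_eq, Set.mem_iInter]
    refine forall₂_congr fun Q _ => ?_
    have := dist_sq_sub_dist_sq P Q 0 x
    rw [sub_zero, ← neg_sub Q P, inner_neg_left] at this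
    rw [← sq_le_sq₀ dist_nonneg dist_nonneg]
    constructor <;> intro h <;> linarith
  rw [h]
  exact convex_iInter₂ fun Q _ => convex_halfSpace_le (innerₛₗ ℝ (Q - P)).isLinear _

/-- By local finiteness only finitely many sites lie within `dist w P + 1` of `w`, and each strict
inequality persists nearby. Farther sites cannot matter within distance 1/2 of `w`. -/
theorem voronoiRegion_mem_nhds {S : Set E3} {P w : E3}
    (hS : ∀ (w : E3) (r : ℝ), (S ∩ Metric.closedBall w r).Finite)
    (h : ∀ R ∈ S, R ≠ P → dist w P < dist w R) : voronoiRegion S P ∈ nhds w := by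
  have h1 : ∀ᶠ x in nhds w, ∀ R ∈ S ∩ Metric.closedBall w (dist w P + 1),
      dist x P ≤ dist x R := by
    refine (Filter.eventually_all_finite (hS w _)).2 fun R hR => ?_
    by_cases hRP : R = P
    · simp [hRP]
    · have hc : Continuous fun x : E3 => dist x R - dist x P := by fun_prop
      filter_upwards [hc.continuousAt.eventually (lt_mem_nhds (sub_pos.2 (h R hR.1 hRP)))]
        with x hx
      exact (sub_pos.1 hx).le
  filter_upwards [h1, Metric.ball_mem_nhds w (show (0 : ℝ) < 1 / 2 by norm_num)] with x hx hxw
  intro R hR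
  by_cases hRw : dist R w ≤ dist w P + 1
  · exact hx R ⟨hR, hRw⟩
  · rw [Metric.mem_ball] at hxw
    have h2 := dist_triangle R x w
    have h3 := dist_triangle x w P
    rw [dist_comm R x] at h2
    linarith

/-- A nonempty convex set contains a point at which only those linear functionals attain their
minimum that are constant on the set. -/
theorem exists_mem_orthogonal_of_nonneg {F : Set E3} (hF : Convex ℝ F) (hne : F.Nonempty) :
    ∃ w ∈ F, ∀ n : E3, (∀ x ∈ F, 0 ≤ inner ℝ n (x - w)) → n ∈ (vectorSpan ℝ F)ᗮ := by
  obtain ⟨t, htF, hspan, hind⟩ := exists_affineIndependent ℝ E3 F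
  have htfin : t.Finite := finite_set_of_fin_dim_affineIndependent ℝ hind
  lift t to Finset E3 using htfin
  have htne : t.Nonempty := by
    rw [← Finset.coe_nonempty, ← affineSpan_nonempty ℝ, hspan]
    exact (affineSpan_nonempty ℝ).2 hne
  have hcard : (0 : ℝ) < t.card := by exact_mod_cast htne.card_pos
  -- The witness is the centroid of an affine basis taken from `F`: nonnegative values with sum 0 on
  -- the basis all vanish.
  refine ⟨∑ x ∈ t, (t.card : ℝ)⁻¹ • x, hF.sum_mem (fun _ _ => by positivity)
    (by simp [hcard.ne']) fun x hx => htF hx, fun n hn => ?_⟩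
  set w : E3 := ∑ x ∈ t, (t.card : ℝ)⁻¹ • x with hw
  have hsum : ∑ x ∈ t, inner ℝ n (x - w) = 0 := by
    rw [← inner_sum, Finset.sum_sub_distrib, Finset.sum_const, hw, ← Finset.smul_sum,
      ← Nat.cast_smul_eq_nsmul ℝ, smul_smul, mul_inv_cancel₀ hcard.ne', one_smul, sub_self,
      inner_zero_right]
  have hz := (Finset.sum_eq_zero_iff_of_nonneg fun x hx => hn x (htF hx)).1 hsum
  have hvs : vectorSpan ℝ F = vectorSpan ℝ (t : Set E3) := by
    rw [← direction_affineSpan, ← direction_affineSpan, hspan]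
  rw [hvs, vectorSpan_def, Submodule.mem_orthogonal']
  intro u hu
  induction hu using Submodule.span_induction with
  | mem u hu =>
    obtain ⟨x, hx, y, hy, rfl⟩ := hu
    have h1 := hz x hx
    have h2 := hz y hy
    change inner ℝ n (x - y) = 0
    rw [← sub_sub_sub_cancel_right x y w, inner_sub_right, h1, h2, sub_zero]
  | zero => simp
  | add u v _ _ hu hv => rw [inner_add_right, hu, hv, add_zero]
  | smul r u _ hu => rw [inner_smul_right, hu, mul_zero]

/-- The points of `S` whose bisector with `P` contains a point closer to `P` than to all other
points of `S`. -/
def strictNeighbors (S : Set E3) (P : E3) : Set E3 :=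
  {Q ∈ S | Q ≠ P ∧ ∃ w, dist w P = dist w Q ∧ ∀ R ∈ S, R ≠ P → R ≠ Q → dist w P < dist w R}

/-- At a relative interior point `w` of `F`, every site `R` as close as `P` has `P - R` orthogonal
to `F`. That complement is a line, and a line through `P` carries at most one further point
equidistant from `w`. -/
theorem exists_strictNeighbor_of_facet {S : Set E3} {P : E3}
    (hS : ∀ (w : E3) (r : ℝ), (S ∩ Metric.closedBall w r).Finite) {F : Set E3}
    (hF : F ∈ facets (voronoiRegion S P)) :
    ∃ Q ∈ strictNeighbors S P, voronoiRegion S P ∩ {x | dist x P = dist x Q} = F := by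
  have hexp : IsExposed ℝ (voronoiRegion S P) F := hF.1
  have hdim : Module.finrank ℝ (vectorSpan ℝ F) = 2 := hF.2
  set C := voronoiRegion S P with hC
  have hne : F.Nonempty := by
    rw [Set.nonempty_iff_ne_empty]
    rintro rfl
    rw [vectorSpan_empty, finrank_bot] at hdim
    omega
  obtain ⟨w, hwF, hw⟩ := exists_mem_orthogonal_of_nonneg
    (hexp.convex (convex_voronoiRegion S P)) hne
  obtain ⟨l, hl⟩ := hexp hne
  have hFC : F ⊆ C := by
    rw [hl]
    exact fun x hx => hx.1
  have hlw : ∀ y ∈ C, l y ≤ l w := by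
    rw [hl] at hwF
    exact hwF.2
  obtain ⟨v, hv⟩ : ∃ v : E3, ∀ x, l x = inner ℝ v x :=
    ⟨(InnerProductSpace.toDual ℝ E3).symm l, fun x => by
      rw [InnerProductSpace.toDual_symm_apply]⟩
  -- At an interior maximum the exposing functional is zero, so `F = C` would have dimension 3.
  have hnotnhds : C ∉ nhds w := by
    intro hCw
    have hv0 : v = 0 := by
      have hcont : Filter.Tendsto (fun ε : ℝ => w + ε • v) (nhds 0) (nhds w) := by
        have : Continuous fun ε : ℝ => w + ε • v := by fun_prop
        simpa using this.tendsto 0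
      have hev : ∀ᶠ ε : ℝ in nhdsWithin 0 (Set.Ioi 0), w + ε • v ∈ C :=
        (hcont.mono_left nhdsWithin_le_nhds) hCw
      obtain ⟨ε, hε, hpos⟩ := (hev.and self_mem_nhdsWithin).exists
      have h1 := hlw _ hε
      rw [hv, hv, inner_add_right, inner_smul_right, real_inner_self_eq_norm_sq] at h1
      have hpos' : 0 < ε := hpos
      have h2 : ‖v‖ ^ 2 ≤ 0 := by
        by_contra! h
        have := mul_pos hpos' h
        linarith
      exact norm_eq_zero.1 (pow_eq_zero_iff two_ne_zero |>.1 (le_antisymm h2 (sq_nonneg _)))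
    have hFeq : F = C := by
      rw [hl]
      ext x
      simp [hv, hv0]
    have hint : (interior F).Nonempty := ⟨w, by rw [hFeq]; exact mem_interior_iff_mem_nhds.2 hCw⟩
    have htop : vectorSpan ℝ F = ⊤ := by
      rw [← direction_affineSpan,
        (hexp.convex (convex_voronoiRegion S P)).interior_nonempty_iff_affineSpan_eq_top.1 hint, AffineSubspace.direction_top]
    rw [htop, finrank_top] at hdim
    simp at hdim
  obtain ⟨Q, hQS, hQP, hQw⟩ : ∃ Q ∈ S, Q ≠ P ∧ dist w Q ≤ dist w P := by
    by_contra! hcon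
    exact hnotnhds (voronoiRegion_mem_nhds hS hcon)
  have horth : ∀ R ∈ S, dist w R ≤ dist w P → P - R ∈ (vectorSpan ℝ F)ᗮ := by
    intro R hR hRw
    refine hw _ fun x hx => ?_
    have h1 := dist_sq_sub_dist_sq P R w x
    have h2 := hFC hx R hR
    have h3 := (sq_le_sq₀ dist_nonneg dist_nonneg).2 h2
    have h4 := (sq_le_sq₀ dist_nonneg dist_nonneg).2 hRw
    linarith
  have hQeq : dist w P = dist w Q := le_antisymm (hFC hwF Q hQS) hQw
  have hrank : Module.finrank ℝ (vectorSpan ℝ F)ᗮ = 1 := by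
    have := Submodule.finrank_add_finrank_orthogonal (vectorSpan ℝ F)
    rw [hdim, finrank_euclideanSpace_fin] at this
    omega
  have hmul : ∀ u ∈ (vectorSpan ℝ F)ᗮ, ∃ s : ℝ, s • (P - Q) = u := by
    intro u hu
    obtain ⟨s, hs⟩ := (finrank_eq_one_iff_of_nonzero'
      (⟨P - Q, horth Q hQS hQw⟩ : (vectorSpan ℝ F)ᗮ)
      (by simpa [sub_eq_zero] using hQP.symm)).1 hrank ⟨u, hu⟩
    exact ⟨s, congrArg Subtype.val hs⟩
  refine ⟨Q, ⟨hQS, hQP, w, hQeq, fun R hR hRP hRQ => ?_⟩, ?_⟩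
  · by_contra! hcon
    obtain ⟨s, hs⟩ := hmul _ (horth R hR hcon)
    have hReq : dist w P = dist w R := le_antisymm (hFC hwF R hR) hcon
    have h1 := dist_sq_sub_dist_sq P Q P w
    have h2 := dist_sq_sub_dist_sq P R P w
    have hR' : R = P - s • (P - Q) := by rw [hs]; abel
    rw [← hs, inner_smul_left, dist_eq_norm P R, ← hs, norm_smul, mul_pow, ← hReq,
      Real.norm_eq_abs, sq_abs] at h2
    rw [← hQeq, dist_eq_norm P Q] at h1
    simp only [dist_self, sub_self, RCLike.conj_to_real] at h1 h2
    -- For `R = P - s (P - Q)`, equidistance from `w` forces `s = 0` or `s = 1`, hence `R = P` or `R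
    -- = Q`.
    have h3 : s * (s - 1) * ‖P - Q‖ ^ 2 = 0 := by
      linear_combination s * h1 - h2
    have h4 : ‖P - Q‖ ^ 2 ≠ 0 := by simpa [sub_eq_zero] using hQP.symm
    rcases mul_eq_zero.1 ((mul_eq_zero.1 h3).resolve_right h4) with h | h
    · exact hRP (by rw [hR', h]; simp)
    · exact hRQ (by rw [hR', sub_eq_zero.1 h]; simp)
  · have hvorth : v ∈ (vectorSpan ℝ F)ᗮ := by
      rw [← neg_mem_iff]
      refine hw _ fun x hx => ?_
      have := hlw x (hFC hx)
      rw [hv, hv] at this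
      rw [inner_neg_left, inner_sub_right]
      linarith
    obtain ⟨s, hs⟩ := hmul v hvorth
    ext x
    constructor
    · rintro ⟨hxC, hxQ⟩
      rw [hl]
      refine ⟨hxC, fun y hy => (hlw y hy).trans (le_of_eq ?_)⟩
      have h1 := dist_sq_sub_dist_sq P Q w x
      rw [← hQeq, show dist x Q = dist x P from hxQ.symm] at h1
      have h2 : inner ℝ (P - Q) (x - w) = 0 := by linarith
      have h3 : inner ℝ v (x - w) = 0 := by rw [← hs, inner_smul_left, h2, mul_zero]
      rw [inner_sub_right] at h3
      rw [hv, hv]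
      linarith
    · intro hx
      refine ⟨hFC hx, ?_⟩
      have h1 := dist_sq_sub_dist_sq P Q w x
      have h2 : inner ℝ (P - Q) (x - w) = 0 :=
        (Submodule.mem_orthogonal' _ _).1 (horth Q hQS hQw) _ (vsub_mem_vectorSpan ℝ hx hwF)
      rw [h2, ← hQeq] at h1
      exact (sq_eq_sq₀ dist_nonneg dist_nonneg).1 (by linarith)

theorem encard_facets_le {S : Set E3} {P : E3}
    (hS : ∀ (w : E3) (r : ℝ), (S ∩ Metric.closedBall w r).Finite) :
    (facets (voronoiRegion S P)).encard ≤ (strictNeighbors S P).encard := by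
  refine (Set.encard_le_encard ?_).trans
    (Set.encard_image_le (fun Q => voronoiRegion S P ∩ {x | dist x P = dist x Q}) _)
  intro F hF
  exact exists_strictNeighbor_of_facet hS hF

/-! ### The orbit under the standard group in coordinates -/

/-- Representatives of the orbit of `p` under the standard group modulo integer translations. -/
noncomputable def orbitRep (p : E3) : Fin 8 → E3 :=
  ![!₂[p 0, p 1, p 2], !₂[-p 1, p 0, p 2 + 1 / 4], !₂[-p 0, -p 1, p 2 + 1 / 2],
    !₂[p 1, -p 0, p 2 + 3 / 4], !₂[p 1, p 0, -p 2 + 3 / 4], !₂[-p 0, p 1, -p 2],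
    !₂[-p 1, -p 0, -p 2 + 1 / 4], !₂[p 0, -p 1, -p 2 + 1 / 2]]

/-- A general point of the orbit of `p` under the standard group. -/
noncomputable def orbitPoint (p : E3) (l : Fin 8 × ℤ × ℤ × ℤ) : E3 :=
  orbitRep p l.1 + !₂[(l.2.1 : ℝ), (l.2.2.1 : ℝ), (l.2.2.2 : ℝ)]

theorem orbitPoint_add_int (p : E3) (m : Fin 8) (i j k a b d : ℤ) :
    (!₂[(a : ℝ), (b : ℝ), (d : ℝ)] : E3) + orbitPoint p (m, i, j, k) =
      orbitPoint p (m, a + i, b + j, d + k) := by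
  ext n
  fin_cases n <;> simp [orbitPoint] <;> ring

theorem screwFour_orbitPoint (p : E3) (l : Fin 8 × ℤ × ℤ × ℤ) :
    screwFour (orbitPoint p l) = orbitPoint p ((![1, 2, 3, 0, 5, 6, 7, 4] : Fin 8 → Fin 8) l.1,
      -l.2.2.1, l.2.1, l.2.2.2 + (![0, 0, 0, 1, 1, 0, 0, 0] : Fin 8 → ℤ) l.1) := by
  obtain ⟨m, i, j, k⟩ := l
  change (!₂[-(orbitPoint p (m, i, j, k)) 1, (orbitPoint p (m, i, j, k)) 0,
    (orbitPoint p (m, i, j, k)) 2 + 1 / 4] : E3) = _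
  ext n
  fin_cases m <;> fin_cases n <;> simp [orbitPoint, orbitRep] <;> ring

theorem screwFour_symm_orbitPoint (p : E3) (l : Fin 8 × ℤ × ℤ × ℤ) :
    screwFour.symm (orbitPoint p l) = orbitPoint p
      ((![3, 0, 1, 2, 7, 4, 5, 6] : Fin 8 → Fin 8) l.1,
      l.2.2.1, -l.2.1, l.2.2.2 - (![1, 0, 0, 0, 0, 1, 0, 0] : Fin 8 → ℤ) l.1) := by
  obtain ⟨m, i, j, k⟩ := l
  change (!₂[(orbitPoint p (m, i, j, k)) 1, -(orbitPoint p (m, i, j, k)) 0,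
    (orbitPoint p (m, i, j, k)) 2 - 1 / 4] : E3) = _
  ext n
  fin_cases m <;> fin_cases n <;> simp [orbitPoint, orbitRep] <;> ring

theorem halfTurnY_orbitPoint (p : E3) (l : Fin 8 × ℤ × ℤ × ℤ) :
    halfTurnY (orbitPoint p l) = orbitPoint p ((![5, 4, 7, 6, 1, 0, 3, 2] : Fin 8 → Fin 8) l.1,
      -l.2.1, l.2.2.1, -l.2.2.2 - (![0, 1, 1, 1, 1, 0, 1, 1] : Fin 8 → ℤ) l.1) := by
  obtain ⟨m, i, j, k⟩ := l
  change (!₂[-(orbitPoint p (m, i, j, k)) 0, (orbitPoint p (m, i, j, k)) 1,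
    -(orbitPoint p (m, i, j, k)) 2] : E3) = _
  ext n
  fin_cases m <;> fin_cases n <;> simp [orbitPoint, orbitRep] <;> ring

theorem exists_orbitPoint_of_mem {h : E3 ≃ᵃ[ℝ] E3} (hh : h ∈ standardP4122) (p : E3) :
    ∃ l, h p = orbitPoint p l := by
  induction hh using Subgroup.closure_induction_left with
  | one => exact ⟨(0, 0, 0, 0), by ext n; fin_cases n <;> simp [orbitPoint, orbitRep]⟩
  | mul_left g hg h _ ih =>
    obtain ⟨⟨m, i, j, k⟩, hl⟩ := ih
    rw [AffineEquiv.mul_def, AffineEquiv.trans_apply, hl]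
    rcases hg with rfl | rfl | rfl | rfl | rfl
    · exact ⟨_, by simpa using orbitPoint_add_int p m i j k 1 0 0⟩
    · exact ⟨_, by simpa using orbitPoint_add_int p m i j k 0 1 0⟩
    · exact ⟨_, by simpa using orbitPoint_add_int p m i j k 0 0 1⟩
    · exact ⟨_, screwFour_orbitPoint p _⟩
    · exact ⟨_, halfTurnY_orbitPoint p _⟩
  | inv_mul_cancel g hg h _ ih =>
    obtain ⟨⟨m, i, j, k⟩, hl⟩ := ih
    rw [AffineEquiv.mul_def, AffineEquiv.trans_apply, hl, AffineEquiv.inv_def]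
    rcases hg with rfl | rfl | rfl | rfl | rfl
    · exact ⟨(m, -1 + i, 0 + j, 0 + k), by
        rw [← orbitPoint_add_int, AffineEquiv.constVAdd_symm, AffineEquiv.constVAdd_apply,
          vadd_eq_add]
        congr 1
        ext n
        fin_cases n <;> simp⟩
    · exact ⟨(m, 0 + i, -1 + j, 0 + k), by
        rw [← orbitPoint_add_int, AffineEquiv.constVAdd_symm, AffineEquiv.constVAdd_apply,
          vadd_eq_add]
        congr 1
        ext n
        fin_cases n <;> simp⟩
    · exact ⟨(m, 0 + i, 0 + j, -1 + k), by
        rw [← orbitPoint_add_int, AffineEquiv.constVAdd_symm, AffineEquiv.constVAdd_apply,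
          vadd_eq_add]
        congr 1
        ext n
        fin_cases n <;> simp⟩
    · exact ⟨_, screwFour_symm_orbitPoint p _⟩
    · exact ⟨_, halfTurnY_orbitPoint p _⟩

theorem constVAdd_int_mem (i j k : ℤ) :
    AffineEquiv.constVAdd ℝ E3 (!₂[(i : ℝ), (j : ℝ), (k : ℝ)] : E3) ∈ standardP4122 := by
  have hv : (!₂[(i : ℝ), (j : ℝ), (k : ℝ)] : E3) =
      i • (!₂[1, 0, 0] : E3) + j • (!₂[0, 1, 0] : E3) + k • (!₂[0, 0, 1] : E3) := by
    ext n
    fin_cases n <;> simp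
  rw [hv, AffineEquiv.constVAdd_add, AffineEquiv.constVAdd_add, AffineEquiv.constVAdd_zsmul,
    AffineEquiv.constVAdd_zsmul, AffineEquiv.constVAdd_zsmul, ← AffineEquiv.mul_def,
    ← AffineEquiv.mul_def]
  exact mul_mem (mul_mem (zpow_mem (Subgroup.subset_closure (by simp)) _)
    (zpow_mem (Subgroup.subset_closure (by simp)) _))
    (zpow_mem (Subgroup.subset_closure (by simp)) _)

theorem screwFour_mem : screwFour ∈ standardP4122 := Subgroup.subset_closure (by simp)

theorem halfTurnY_mem : halfTurnY ∈ standardP4122 := Subgroup.subset_closure (by simp)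

theorem exists_mem_orbitPoint (p : E3) (l : Fin 8 × ℤ × ℤ × ℤ) :
    ∃ h ∈ standardP4122, h p = orbitPoint p l := by
  have step : ∀ g ∈ standardP4122, ∀ u, (∃ h ∈ standardP4122, h p = u) →
      ∃ h ∈ standardP4122, h p = g u := by
    rintro g hg u ⟨h, hh, rfl⟩
    exact ⟨g * h, mul_mem hg hh, rfl⟩
  have h0 : ∃ h ∈ standardP4122, h p = orbitPoint p (0, 0, 0, 0) :=
    ⟨1, one_mem _, by ext n; fin_cases n <;> simp [orbitPoint, orbitRep]⟩
  have h1 := step _ screwFour_mem _ h0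
  rw [screwFour_orbitPoint] at h1
  have h2 := step _ screwFour_mem _ h1
  rw [screwFour_orbitPoint] at h2
  have h3 := step _ screwFour_mem _ h2
  rw [screwFour_orbitPoint] at h3
  -- The screw runs through cosets 0, 1, 2, 3 from the base point and through 5, 6, 7, 4 from its
  -- half turn.
  have h5 := step _ halfTurnY_mem _ h0
  rw [halfTurnY_orbitPoint] at h5
  have h6 := step _ screwFour_mem _ h5
  rw [screwFour_orbitPoint] at h6
  have h7 := step _ screwFour_mem _ h6
  rw [screwFour_orbitPoint] at h7
  have h4 := step _ screwFour_mem _ h7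
  rw [screwFour_orbitPoint] at h4
  have hrep : ∀ m, ∃ a b d, ∃ h ∈ standardP4122, h p = orbitPoint p (m, a, b, d) := by
    intro m
    fin_cases m
    exacts [⟨_, _, _, h0⟩, ⟨_, _, _, h1⟩, ⟨_, _, _, h2⟩, ⟨_, _, _, h3⟩, ⟨_, _, _, h4⟩,
      ⟨_, _, _, h5⟩, ⟨_, _, _, h6⟩, ⟨_, _, _, h7⟩]
  obtain ⟨m, i, j, k⟩ := l
  obtain ⟨a, b, d, hm⟩ := hrep m
  have := step _ (constVAdd_int_mem (i - a) (j - b) (k - d)) _ hm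
  rw [AffineEquiv.constVAdd_apply, vadd_eq_add, orbitPoint_add_int] at this
  simpa using this

/-- Every orbit has a point over the fundamental triangle of the projected group. -/
theorem exists_mem_fundamental (p : E3) :
    ∃ h ∈ standardP4122, 0 ≤ h p 1 ∧ h p 1 ≤ h p 0 ∧ h p 0 ≤ 1 / 2 := by
  suffices h : ∃ l, 0 ≤ orbitPoint p l 1 ∧ orbitPoint p l 1 ≤ orbitPoint p l 0 ∧
      orbitPoint p l 0 ≤ 1 / 2 by
    obtain ⟨l, hl⟩ := h
    obtain ⟨h, hh, he⟩ := exists_mem_orbitPoint p l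
    exact ⟨h, hh, by rwa [he]⟩
  -- After rounding, both horizontal coordinates lie in `[-1/2, 1/2]`. The two signs and the order
  -- of the absolute values single out one of the eight cosets.
  have hx := abs_le.1 (abs_sub_round (p 0))
  have hy := abs_le.1 (abs_sub_round (p 1))
  set a := round (p 0)
  set b := round (p 1)
  rcases le_total (a : ℝ) (p 0) with h1 | h1 <;> rcases le_total (b : ℝ) (p 1) with h2 | h2
  · rcases le_total (p 1 - b) (p 0 - a) with h3 | h3
    · refine ⟨(0, -a, -b, 0), ?_⟩
      simp [orbitPoint, orbitRep]
      refine ⟨?_, ?_, ?_⟩ <;> linarith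
    · refine ⟨(4, -b, -a, 0), ?_⟩
      simp [orbitPoint, orbitRep]
      refine ⟨?_, ?_, ?_⟩ <;> linarith
  · rcases le_total (b - p 1) (p 0 - a) with h3 | h3
    · refine ⟨(7, -a, b, 0), ?_⟩
      simp [orbitPoint, orbitRep]
      refine ⟨?_, ?_, ?_⟩ <;> linarith
    · refine ⟨(1, b, -a, 0), ?_⟩
      simp [orbitPoint, orbitRep]
      refine ⟨?_, ?_, ?_⟩ <;> linarith
  · rcases le_total (p 1 - b) (a - p 0) with h3 | h3
    · refine ⟨(5, a, -b, 0), ?_⟩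
      simp [orbitPoint, orbitRep]
      refine ⟨?_, ?_, ?_⟩ <;> linarith
    · refine ⟨(3, -b, a, 0), ?_⟩
      simp [orbitPoint, orbitRep]
      refine ⟨?_, ?_, ?_⟩ <;> linarith
  · rcases le_total (b - p 1) (a - p 0) with h3 | h3
    · refine ⟨(2, a, b, 0), ?_⟩
      simp [orbitPoint, orbitRep]
      refine ⟨?_, ?_, ?_⟩ <;> linarith
    · refine ⟨(6, b, a, 0), ?_⟩
      simp [orbitPoint, orbitRep]
      refine ⟨?_, ?_, ?_⟩ <;> linarith

/-- The vector of Euclidean space with given coordinates. -/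
noncomputable def ofTriple (v : ℝ × ℝ × ℝ) : E3 := !₂[v.1, v.2.1, v.2.2]

theorem range_orbitPoint (p : E3) :
    Set.range (orbitPoint p) =
      Set.range fun l => p + ofTriple (site (p 0) (p 1) (Int.fract (3 / 4 - 2 * p 2)) l) := by
  -- The integer part of `3/4 - 2z` is absorbed into the vertical label. The extra `-1` reflects
  -- that cosets 5, 6, 7 sit at `t - 3/4`, `t - 1/2`, `t - 1/4`, while `offset` records these
  -- heights plus 1.
  have key : ∀ m i j k, orbitPoint p (m, i, j, k) =
      p + ofTriple (site (p 0) (p 1) (Int.fract (3 / 4 - 2 * p 2))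
        (m, i, j, k + (![0, 0, 0, 0, ⌊3 / 4 - 2 * p 2⌋, ⌊3 / 4 - 2 * p 2⌋ - 1,
          ⌊3 / 4 - 2 * p 2⌋ - 1, ⌊3 / 4 - 2 * p 2⌋ - 1] : Fin 8 → ℤ) m)) := by
    intro m i j k
    ext n
    fin_cases m <;> fin_cases n <;>
      simp [orbitPoint, orbitRep, ofTriple, site, offset, ← Int.self_sub_floor] <;>
      ring
  apply Set.Subset.antisymm
  · rintro _ ⟨⟨m, i, j, k⟩, rfl⟩
    exact ⟨_, (key m i j k).symm⟩
  · rintro _ ⟨⟨m, i, j, k⟩, rfl⟩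
    refine ⟨(m, i, j, k - (![0, 0, 0, 0, ⌊3 / 4 - 2 * p 2⌋, ⌊3 / 4 - 2 * p 2⌋ - 1,
          ⌊3 / 4 - 2 * p 2⌋ - 1, ⌊3 / 4 - 2 * p 2⌋ - 1] : Fin 8 → ℤ) m), ?_⟩
    rw [key, sub_add_cancel]

/-! ### Transport to a group of type `P4₁22` and its metric -/

theorem orbitOf_eq_range {G : Subgroup (E3 ≃ᵃⁱ[ℝ] E3)} {φ : E3 ≃ᵃ[ℝ] E3}
    (hφ : (fun g : E3 ≃ᵃⁱ[ℝ] E3 => g.toAffineEquiv) '' (G : Set (E3 ≃ᵃⁱ[ℝ] E3)) =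
      (fun h : E3 ≃ᵃ[ℝ] E3 => φ * h * φ⁻¹) '' (standardP4122 : Set (E3 ≃ᵃ[ℝ] E3))) (p : E3) :
    orbitOf G (φ p) = Set.range fun l => φ (orbitPoint p l) := by
  have conj : ∀ h : E3 ≃ᵃ[ℝ] E3, (φ * h * φ⁻¹) (φ p) = φ (h p) := fun h => by
    change φ (h (φ.symm (φ p))) = _
    rw [AffineEquiv.symm_apply_apply]
  ext Q
  constructor
  · rintro ⟨g, hg, rfl⟩
    obtain ⟨h, hh, he⟩ := hφ.subset ⟨g, hg, rfl⟩
    obtain ⟨l, hl⟩ := exists_orbitPoint_of_mem hh p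
    refine ⟨l, ?_⟩
    change φ (orbitPoint p l) = g (φ p)
    rw [← hl, ← conj h]
    exact congrArg (fun e : E3 ≃ᵃ[ℝ] E3 => e (φ p)) he
  · rintro ⟨l, rfl⟩
    obtain ⟨h, hh, hl⟩ := exists_mem_orbitPoint p l
    obtain ⟨g, hg, he⟩ := hφ.superset ⟨h, hh, rfl⟩
    refine ⟨g, hg, ?_⟩
    change g (φ p) = φ (orbitPoint p l)
    rw [← hl, ← conj h]
    exact congrArg (fun e : E3 ≃ᵃ[ℝ] E3 => e (φ p)) he

theorem dist_map_of_mem {G : Subgroup (E3 ≃ᵃⁱ[ℝ] E3)} {φ : E3 ≃ᵃ[ℝ] E3}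
    (hφ : (fun g : E3 ≃ᵃⁱ[ℝ] E3 => g.toAffineEquiv) '' (G : Set (E3 ≃ᵃⁱ[ℝ] E3)) =
      (fun h : E3 ≃ᵃ[ℝ] E3 => φ * h * φ⁻¹) '' (standardP4122 : Set (E3 ≃ᵃ[ℝ] E3)))
    {h : E3 ≃ᵃ[ℝ] E3} (hh : h ∈ standardP4122) (u v : E3) :
    dist (φ (h u)) (φ (h v)) = dist (φ u) (φ v) := by
  obtain ⟨g, hg, he⟩ := hφ.superset ⟨h, hh, rfl⟩
  have key : ∀ u, g (φ u) = φ (h u) := fun u => by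
    have := congrArg (fun e : E3 ≃ᵃ[ℝ] E3 => e (φ u)) he
    change g (φ u) = φ (h (φ.symm (φ u))) at this
    rwa [AffineEquiv.symm_apply_apply] at this
  rw [← key, ← key, g.dist_map]

/-- The Euclidean metric, pulled back to the coordinates of the standard group, is tetragonal. -/
theorem exists_tetragonal_form {G : Subgroup (E3 ≃ᵃⁱ[ℝ] E3)} {φ : E3 ≃ᵃ[ℝ] E3}
    (hφ : (fun g : E3 ≃ᵃⁱ[ℝ] E3 => g.toAffineEquiv) '' (G : Set (E3 ≃ᵃⁱ[ℝ] E3)) =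
      (fun h : E3 ≃ᵃ[ℝ] E3 => φ * h * φ⁻¹) '' (standardP4122 : Set (E3 ≃ᵃ[ℝ] E3))) :
    ∃ a c : ℝ, 0 < a ∧ 0 < c ∧ ∀ u v : E3, dist (φ u) (φ v) ^ 2 =
      a * ((u 0 - v 0) ^ 2 + (u 1 - v 1) ^ 2 + c * (u 2 - v 2) ^ 2) := by
  have hdist : ∀ u v : E3, dist (φ u) (φ v) = ‖φ.linear (u - v)‖ := fun u v => by
    rw [dist_eq_norm, ← vsub_eq_sub (φ u), ← vsub_eq_sub u]
    exact congrArg norm (φ.toAffineMap.linearMap_vsub u v).symm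
  set A := φ.linear
  set e₀ : E3 := !₂[1, 0, 0]
  set e₁ : E3 := !₂[0, 1, 0]
  set e₂ : E3 := !₂[0, 0, 1]
  have hdecomp : ∀ v : E3, v = v 0 • e₀ + v 1 • e₁ + v 2 • e₂ := fun v => by
    ext n
    fin_cases n <;> simp [e₀, e₁, e₂]
  have hform : ∀ r s q : ℝ, ‖A (r • e₀ + s • e₁ + q • e₂)‖ ^ 2 =
      r ^ 2 * ‖A e₀‖ ^ 2 + s ^ 2 * ‖A e₁‖ ^ 2 + q ^ 2 * ‖A e₂‖ ^ 2 +
      2 * (r * s * inner ℝ (A e₀) (A e₁) + r * q * inner ℝ (A e₀) (A e₂) +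
        s * q * inner ℝ (A e₁) (A e₂)) := fun r s q => by
    rw [map_add, map_add, map_smul, map_smul, map_smul, norm_add_sq_real, norm_add_sq_real,
      inner_add_left]
    simp only [norm_smul, mul_pow, Real.norm_eq_abs, sq_abs, inner_smul_left, inner_smul_right,
      RCLike.conj_to_real]
    ring
  have hscrew : ∀ r s q : ℝ, ‖A (-s • e₀ + r • e₁ + q • e₂)‖ = ‖A (r • e₀ + s • e₁ + q • e₂)‖ := by
    intro r s q
    have := dist_map_of_mem hφ screwFour_mem (r • e₀ + s • e₁ + q • e₂) 0
    rw [hdist, hdist, sub_zero] at this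
    rw [← this]
    congr 2
    ext n
    fin_cases n <;> simp [screwFour, e₀, e₁, e₂]
  have hturn : ∀ r s q : ℝ, ‖A (-r • e₀ + s • e₁ + -q • e₂)‖ = ‖A (r • e₀ + s • e₁ + q • e₂)‖ := by
    intro r s q
    have := dist_map_of_mem hφ halfTurnY_mem (r • e₀ + s • e₁ + q • e₂) 0
    rw [hdist, hdist, sub_zero] at this
    rw [← this]
    congr 2
    ext n
    fin_cases n <;> simp [halfTurnY, e₀, e₁, e₂]
  -- In order, these give equal lengths of the horizontal axis vectors, their orthogonality,
  -- orthogonality of the second and third axis, and equality of the products of the two horizontal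
  -- axes with the third.
  have h1 := congrArg (· ^ 2) (hscrew 1 0 0)
  have h2 := congrArg (· ^ 2) (hturn 1 1 0)
  have h3 := congrArg (· ^ 2) (hturn 0 1 1)
  have h4 := congrArg (· ^ 2) (hscrew 1 0 1)
  simp only [hform] at h1 h2 h3 h4
  have h01 : inner ℝ (A e₀) (A e₁) = 0 := by linarith
  have h12 : inner ℝ (A e₁) (A e₂) = 0 := by linarith
  have h02 : inner ℝ (A e₀) (A e₂) = 0 := by linarith
  have pos : ∀ e : E3, e ≠ 0 → 0 < ‖A e‖ ^ 2 := fun e he =>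
    pow_pos (norm_pos_iff.2 (by simpa using he)) 2
  have p0 : 0 < ‖A e₀‖ ^ 2 := pos _ fun h => by
    simpa [e₀] using congrArg (fun v : E3 => v 0) h
  have p2 : 0 < ‖A e₂‖ ^ 2 := pos _ fun h => by
    simpa [e₂] using congrArg (fun v : E3 => v 2) h
  refine ⟨‖A e₀‖ ^ 2, ‖A e₂‖ ^ 2 / ‖A e₀‖ ^ 2, p0, div_pos p2 p0, fun u v => ?_⟩
  rw [hdist, hdecomp (u - v), hform, h01, h12, h02, show ‖A e₁‖ ^ 2 = ‖A e₀‖ ^ 2 by linarith]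
  have hne : ‖A e₀‖ ≠ 0 := fun h => p0.ne' (by simp [h])
  simp only [PiLp.sub_apply]
  field_simp
  ring

theorem finite_setOf_abs_int_le (o r : ℝ) : {n : ℤ | |o + n| ≤ r}.Finite := by
  refine (Set.finite_Icc ⌈-r - o⌉ ⌊r - o⌋).subset fun n hn => ?_
  have h := abs_le.1 (show |o + n| ≤ r from hn)
  exact ⟨Int.ceil_le.2 (by linarith), Int.le_floor.2 (by linarith)⟩

theorem finite_orbit_inter_closedBall {φ : E3 ≃ᵃ[ℝ] E3} {a c : ℝ} (ha : 0 < a) (hc : 0 < c)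
    (hform : ∀ u v : E3, dist (φ u) (φ v) ^ 2 =
      a * ((u 0 - v 0) ^ 2 + (u 1 - v 1) ^ 2 + c * (u 2 - v 2) ^ 2)) (p w : E3) (r : ℝ) :
    ((Set.range fun l => φ (orbitPoint p l)) ∩ Metric.closedBall w r).Finite := by
  obtain ⟨v, rfl⟩ := φ.surjective w
  have hbound : ∀ {s b : ℝ}, 0 < b → b * s ^ 2 ≤ r ^ 2 → |s| ≤ √(r ^ 2 / b) := by
    intro s b hb h
    refine Real.abs_le_sqrt ?_
    rw [le_div_iff₀ hb]
    linarith
  have hfin : ∀ m, {n : ℤ × ℤ × ℤ | dist (φ (orbitPoint p (m, n))) (φ v) ≤ r}.Finite := by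
    intro m
    refine ((finite_setOf_abs_int_le (orbitRep p m 0 - v 0) (√(r ^ 2 / a))).prod
      ((finite_setOf_abs_int_le (orbitRep p m 1 - v 1) (√(r ^ 2 / a))).prod
      (finite_setOf_abs_int_le (orbitRep p m 2 - v 2) (√(r ^ 2 / (a * c)))))).subset ?_
    rintro ⟨i, j, k⟩ hn
    have h := pow_le_pow_left₀ dist_nonneg
      (show dist (φ (orbitPoint p (m, i, j, k))) (φ v) ≤ r from hn) 2
    rw [hform] at h
    simp only [orbitPoint, PiLp.add_apply, Matrix.cons_val] at h
    have q0 := mul_nonneg ha.le (sq_nonneg (orbitRep p m 0 + i - v 0))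
    have q1 := mul_nonneg ha.le (sq_nonneg (orbitRep p m 1 + j - v 1))
    have q2 := mul_nonneg (mul_pos ha hc).le (sq_nonneg (orbitRep p m 2 + k - v 2))
    refine ⟨?_, ?_, ?_⟩
    · refine hbound ha ?_
      rw [sub_add_eq_add_sub]
      linarith
    · refine hbound ha ?_
      rw [sub_add_eq_add_sub]
      linarith
    · refine hbound (mul_pos ha hc) ?_
      rw [sub_add_eq_add_sub]
      linarith
  refine (Set.finite_iUnion fun m =>
    (hfin m).image fun n => φ (orbitPoint p (m, n))).subset ?_
  rintro _ ⟨⟨⟨m, n⟩, rfl⟩, h⟩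
  exact Set.mem_iUnion.2 ⟨m, n, h, rfl⟩

theorem strictNeighbors_subset {φ : E3 ≃ᵃ[ℝ] E3} {a c x y t : ℝ} {p : E3} (ha : 0 < a)
    (hform : ∀ u v : E3, dist (φ u) (φ v) ^ 2 =
      a * ((u 0 - v 0) ^ 2 + (u 1 - v 1) ^ 2 + c * (u 2 - v 2) ^ 2))
    {T : Finset (Fin 8 × ℤ × ℤ × ℤ)} (hT : CoversNeighbors c x y t T) :
    strictNeighbors (Set.range fun l => φ (p + ofTriple (site x y t l))) (φ p) ⊆
      (fun l => φ (p + ofTriple (site x y t l))) '' (T : Set (Fin 8 × ℤ × ℤ × ℤ)) := by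
  have hinj : ∀ u v, φ (p + ofTriple u) = φ (p + ofTriple v) → u = v := by
    rintro ⟨u₀, u₁, u₂⟩ ⟨v₀, v₁, v₂⟩ h
    have h := add_left_cancel (φ.injective h)
    have h0 := congrArg (fun v : E3 => v 0) h
    have h1 := congrArg (fun v : E3 => v 1) h
    have h2 := congrArg (fun v : E3 => v 2) h
    simp [ofTriple] at h0 h1 h2
    simp [h0, h1, h2]
  have hzero : φ p = φ (p + ofTriple 0) := by
    congr 1
    ext n
    fin_cases n <;> simp [ofTriple]
  rintro _ ⟨⟨l, rfl⟩, hne, w, hw, hlt⟩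
  obtain ⟨v, rfl⟩ := φ.surjective w
  -- Up to the factor `a`, `power` is the difference of squared distances; this fixes the values of
  -- `α`, `β`, `γ`.
  have hpow : ∀ R, dist (φ v) (φ (p + ofTriple R)) ^ 2 - dist (φ v) (φ p) ^ 2 =
      a * power c (2 * (v 0 - p 0)) (2 * (v 1 - p 1)) (2 * c * (v 2 - p 2)) R := by
    intro R
    rw [hform, hform]
    simp [power, ofTriple]
    ring
  have hnb : IsNeighbor c x y t (2 * (v 0 - p 0)) (2 * (v 1 - p 1)) (2 * c * (v 2 - p 2))
      (site x y t l) := by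
    refine ⟨?_, fun R hR hRQ => ?_⟩
    · have := hpow (site x y t l)
      rw [hw, sub_self] at this
      exact (mul_eq_zero.1 this.symm).resolve_left ha.ne'
    · have h1 := hlt _ ⟨R, rfl⟩ (fun h => hR (hinj _ _ (by rw [← hzero]; exact h)))
        (fun h => hRQ (hinj _ _ h))
      have h2 := hpow (site x y t R)
      have h3 := pow_lt_pow_left₀ h1 dist_nonneg two_ne_zero
      exact pos_of_mul_pos_right (by rw [← h2]; exact sub_pos.2 h3) ha.le
  obtain ⟨l', hl', he⟩ := hT l (fun h0 => hne (by simp only [h0]; exact hzero.symm))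
    ⟨_, _, _, hnb⟩
  exact ⟨l', hl', by simp only [he]⟩

theorem mainTheorem11 (G : Subgroup (E3 ≃ᵃⁱ[ℝ] E3)) (hG : IsOfTypeP4122 G)
    (C : Set E3) (hC : IsDirichletStereohedron G C) :
    (facets C).encard ≤ 50 := by
  obtain ⟨P, rfl⟩ := hC
  obtain ⟨ψ, hψ⟩ := hG
  obtain ⟨k, hk, hy, hyx, hx⟩ := exists_mem_fundamental (ψ.symm P)
  obtain ⟨φ, p, rfl, hφ, hp⟩ : ∃ (φ : E3 ≃ᵃ[ℝ] E3) (p : E3), φ p = P ∧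
      ((fun g : E3 ≃ᵃⁱ[ℝ] E3 => g.toAffineEquiv) '' (G : Set (E3 ≃ᵃⁱ[ℝ] E3)) =
        (fun h : E3 ≃ᵃ[ℝ] E3 => φ * h * φ⁻¹) '' (standardP4122 : Set (E3 ≃ᵃ[ℝ] E3))) ∧
      0 ≤ p 1 ∧ p 1 ≤ p 0 ∧ p 0 ≤ 1 / 2 := by
    -- Since `k` lies in the standard group, replacing `ψ` by `ψ * k⁻¹` leaves the conjugate group
    -- unchanged and moves the coordinates of `P` into the triangle.
    refine ⟨ψ * k⁻¹, k (ψ.symm P), ?_, ?_, hy, hyx, hx⟩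
    · change ψ (k.symm (k (ψ.symm P))) = P
      simp
    · rw [hψ]
      ext e
      constructor
      · rintro ⟨h, hh, rfl⟩
        exact ⟨k * h * k⁻¹, mul_mem (mul_mem hk hh) (inv_mem hk), by group⟩
      · rintro ⟨h, hh, rfl⟩
        exact ⟨k⁻¹ * h * k, mul_mem (mul_mem (inv_mem hk) hh) hk, by group⟩
  obtain ⟨a, c, ha, hc, hform⟩ := exists_tetragonal_form hφ
  obtain ⟨T, hcard, hT⟩ := exists_covers (c := c) hc hp.1 hp.2.1 hp.2.2
    (Int.fract_nonneg (3 / 4 - 2 * p 2)) (Int.fract_lt_one _)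
  rw [orbitOf_eq_range hφ]
  refine (encard_facets_le (finite_orbit_inter_closedBall ha hc hform p)).trans ?_
  have hrange : (Set.range fun l => φ (orbitPoint p l)) = Set.range fun l =>
      φ (p + ofTriple (site (p 0) (p 1) (Int.fract (3 / 4 - 2 * p 2)) l)) := by
    rw [← Function.comp_def φ, Set.range_comp, range_orbitPoint, ← Set.range_comp]
    rfl
  rw [hrange]
  refine (Set.encard_le_encard (strictNeighbors_subset ha hform hT)).trans
    ((Set.encard_image_le _ _).trans ?_)
  rw [Set.encard_coe_eq_coe_finsetCard]
  exact_mod_cast hcard
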